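/- Let $\mathbb D$ be the open unit disk in $\mathbb C$, $dA$ the normalized Lebesgue area measure on $\mathbb D$, and let $\nu$ be a finite positive Borel measure on $[0,1]$. For $f\in L^1(\mathbb D)$ put $$T_\nu f(z)=\int_{\mathbb D}\frac1{1-z\overline\lambda}\left(\int_0^1\frac{d\nu(r)}{1-rz\overline\lambda}\right)f(\lambda)\,dA(\lambda),\qquad z\in\mathbb D .$$ For $c\ge 1$ let $c'\in[1,\infty]$ denote the dual index, $1/c+1/c'=1$, and define $$c_\nu=\sup\left\{1\le c<2:\ \int_0^1\frac{d\nu(r)}{(1-r^2)^{2/c'}}<\infty\right\}$$ (where $2/c'=0$ and the integrand is identically $1$ when $c=1$). Let $L^{q,\infty}(\mathbb D)$ be the weak $L^q$ space of measurable $f$ with $$\|f\|_{L^{q,\infty}}=\inf\left\{C>0:\ |\{z\in\mathbb D:|f(z)|>t\}|\le C^q/t^q\ \text{ for all } t>0\right\}<\infty ,$$ where $|\cdot|$ is the measure $dA$. Suppose $1<p<c_\nu'$, and let $q$ be given by $$\frac1q=\frac1p+\frac1{c_\nu}-1 .$$ (a) If $1\le c_\nu<2$, the following are equivalent: (1) $T_\nu:L^p(\mathbb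 D)\to L^{q,\infty}(\mathbb D)$ is bounded; (2) $T_\nu:L^p(\mathbb D)\to L^q(\mathbb D)$ is bounded; (3) $\nu$ satisfies the $2/c_\nu'$-Carleson condition, i.e. $\displaystyle\sup_{0<t\le1}\frac{\nu([1-t,1))}{t^{2/c_\nu'}}<\infty$. (b) If $c_\nu=2$ (whence $1<p<2$ and $q=\frac{2p}{2-p}$), the following are equivalent: (1) $T_\nu:L^p(\mathbb D)\to L^{q,\infty}(\mathbb D)$ is bounded; (2) $T_\nu:L^p(\mathbb D)\to L^q(\mathbb D)$ is bounded; (3) $\nu$ is integrable with respect to the hyperbolic arc length on $[0,1)$, i.e. $\displaystyle\int_{[0,1)}\frac{d\nu(r)}{1-r^2}<\infty$. -/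

import Mathlib

open MeasureTheory Set
open scoped ENNReal NNReal ComplexConjugate

noncomputable section

namespace Shimorin

/-- Normalized Lebesgue area measure `dA` on the open unit disk, as a measure on `ℂ` which
vanishes outside the disk. Functions on the disk are represented by functions on `ℂ`, whose
values outside the disk are irrelevant. -/
def diskMeasure : Measure ℂ :=
  (ENNReal.ofReal Real.pi)⁻¹ • (volume : Measure ℂ).restrict (Metric.ball (0 : ℂ) 1)

/-- The Shimorin-type kernel
`K_ν(z, w) = 1 / (1 - z w̄) * ∫ 1 / (1 - r z w̄) dν(r)`. -/
def kernel (ν : Measure (Icc (0 : ℝ) 1)) (z w : ℂ) : ℂ :=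
  1 / (1 - z * conj w) * ∫ r : Icc (0 : ℝ) 1, 1 / (1 - ((r : ℝ) : ℂ) * z * conj w) ∂ν

/-- The Shimorin-type operator `T_ν f(z) = ∫ K_ν(z, w) f(w) dA(w)` over the unit disk. -/
def T (ν : Measure (Icc (0 : ℝ) 1)) (f : ℂ → ℂ) (z : ℂ) : ℂ :=
  ∫ w, kernel ν z w * f w ∂diskMeasure

/-- The dual index `c'` of `c ≥ 1`, i.e. `1/c + 1/c' = 1`, with values in `[1, ∞]`. -/
def dualIndex (c : ℝ) : ℝ≥0∞ := ENNReal.conjExponent (ENNReal.ofReal c)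

/-- The real number `2 / c'` (equal to `0` when `c' = ∞`). -/
def twoDivDual (c : ℝ) : ℝ := (2 / dualIndex c).toReal

/-- The critical index
`c_ν = sup {1 ≤ c < 2 : ∫ (1 - r²) ^ (-2 / c') dν(r) < ∞}`.
The integral is taken in `[0, ∞]`, with `1 / 0 ^ s = ∞` for `s > 0` and `1 / 0 ^ 0 = 1`. -/
def criticalIndex (ν : Measure (Icc (0 : ℝ) 1)) : ℝ :=
  sSup {c : ℝ | 1 ≤ c ∧ c < 2 ∧
    (∫⁻ r : Icc (0 : ℝ) 1, 1 / ENNReal.ofReal (1 - (r : ℝ) ^ 2) ^ twoDivDual c ∂ν) < ∞}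

/-- The distribution function `d_f(t) = |{z ∈ 𝔻 : |f(z)| > t}|`. -/
def distribution (f : ℂ → ℂ) (t : ℝ) : ℝ≥0∞ := diskMeasure {z | t < ‖f z‖}

/-- The weak `L^q` quasi-norm on the disk,
`inf {C > 0 : d_f(t) ≤ C ^ q / t ^ q for all t > 0}` (equal to `∞` if there is no such finite
`C`). -/
def weakNorm (f : ℂ → ℂ) (q : ℝ) : ℝ≥0∞ :=
  sInf {C : ℝ≥0∞ | 0 < C ∧
    ∀ t : ℝ, 0 < t → distribution f t ≤ C ^ q / ENNReal.ofReal t ^ q}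

/-- Membership in weak `L^q` of the disk. -/
def MemWeakLp (f : ℂ → ℂ) (q : ℝ) : Prop :=
  AEStronglyMeasurable f diskMeasure ∧ weakNorm f q < ∞

/-- The operator `S` is bounded from `L^p(𝔻)` to `L^q(𝔻)`. -/
def StrongType (S : (ℂ → ℂ) → ℂ → ℂ) (p q : ℝ) : Prop :=
  ∃ C : ℝ≥0, ∀ f : ℂ → ℂ, MemLp f (ENNReal.ofReal p) diskMeasure →
    MemLp (S f) (ENNReal.ofReal q) diskMeasure ∧
    eLpNorm (S f) (ENNReal.ofReal q) diskMeasure ≤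
      C * eLpNorm f (ENNReal.ofReal p) diskMeasure

/-- The operator `S` is bounded from `L^p(𝔻)` to `L^{q,∞}(𝔻)`. -/
def WeakType (S : (ℂ → ℂ) → ℂ → ℂ) (p q : ℝ) : Prop :=
  ∃ C : ℝ≥0, ∀ f : ℂ → ℂ, MemLp f (ENNReal.ofReal p) diskMeasure →
    MemWeakLp (S f) q ∧
    weakNorm (S f) q ≤ C * eLpNorm f (ENNReal.ofReal p) diskMeasure

/-- The `α`-Carleson condition: `sup_{0 < t ≤ 1} ν([1 - t, 1)) / t ^ α < ∞`. -/
def IsCarleson (α : ℝ) (ν : Measure (Icc (0 : ℝ) 1)) : Prop :=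
  (⨆ t ∈ Ioc (0 : ℝ) 1,
    ν {r | 1 - t ≤ (r : ℝ) ∧ (r : ℝ) < 1} / ENNReal.ofReal t ^ α) < ∞

/-- Integrability with respect to the hyperbolic arc length on `[0, 1)`:
`∫_{[0,1)} 1 / (1 - r²) dν(r) < ∞`. -/
def HyperbolicIntegrable (ν : Measure (Icc (0 : ℝ) 1)) : Prop :=
  (∫⁻ r in {r : Icc (0 : ℝ) 1 | (r : ℝ) < 1}, ENNReal.ofReal (1 / (1 - (r : ℝ) ^ 2)) ∂ν) < ∞

end Shimorin

end

open MeasureTheory Set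
open scoped ENNReal NNReal ComplexConjugate

namespace Shimorin

/-! Everything is governed by `growth`, G(t) = ∫ dν(r)/(1 - r + t). Write c = c_ν. In both cases (a)
and (b) each of the three conditions is equivalent to G(t) ≤ C t^(1 - 2/c) on (0,1].

Growth implies strong type: |1 - rζ| is comparable from below to 1 - r + |1 - ζ|, so |K_ν(z,w)| is
at most a constant times G(δ)/δ with δ = |1 - z w̄|. The growth bound then dominates the kernel by a
multiple of δ^(-2/c). Since 2/c = 2/p' + 2/q, an L^p to L^q Schur test (`lintegral_schur`) with
weights (1 - |w|²)^(-s) reduces the claim to the Forelli–Rudin estimate (`lintegral_forelli_rudin`).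

Weak type implies growth: on a disk B of radius t/16 centred at 1 - t, the real part of the kernel
is at least a multiple of G(t)/t (`re_kernel_ge`). Hence |T_ν 1_B| ≥ const · t G(t) on B, and the
weak-type inequality for 1_B, with |B| of order t², gives the growth bound
(`growth_le_of_weakType`).

Growth versus ν: for c < 2 and α = 2/c' = 2 - 2/c < 1, Chebyshev and a layer-cake integral identify
G(t) ≤ C t^(α-1) with the α-Carleson condition. For c = 2 the condition says that G is bounded,
which is hyperbolic integrability by Fatou. Conditions (3) do not see an atom at r = 1; this is
harmless because c > 1 forces ν({1}) = 0, while for c = 1 the growth bound holds for every finite ν.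
-/

/-! ### Poisson integrals and the Forelli–Rudin estimate. -/

/-- The Poisson kernel reproduces the constant function 1. -/
theorem lintegral_poisson {a : ℂ} (ha : ‖a‖ < 1) :
    ∫⁻ θ in Ioo (-Real.pi) Real.pi,
      ENNReal.ofReal (1 / ‖Complex.exp (θ * Complex.I) - a‖ ^ 2) =
      ENNReal.ofReal (2 * Real.pi / (1 - ‖a‖ ^ 2)) := by
  have hne : ∀ θ : ℝ, ‖Complex.exp (θ * Complex.I) - a‖ ≠ 0 := fun θ h => by
    rw [norm_eq_zero, sub_eq_zero] at h
    rw [← h, Complex.norm_exp_ofReal_mul_I] at ha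
    exact lt_irrefl _ ha
  have hpos : 0 < 1 - ‖a‖ ^ 2 := by nlinarith [norm_nonneg a]
  have hcont : Continuous fun θ : ℝ => 1 / ‖Complex.exp (θ * Complex.I) - a‖ ^ 2 :=
    continuous_const.div (by fun_prop) fun θ => pow_ne_zero 2 (hne θ)
  have hpois : ∫ θ in (0 : ℝ)..2 * Real.pi,
      1 / ‖Complex.exp (((θ + -Real.pi : ℝ) : ℂ) * Complex.I) - a‖ ^ 2 =
      2 * Real.pi / (1 - ‖a‖ ^ 2) := by
    have h := (diffContOnCl_const (𝕜 := ℂ) (c := (1 : ℂ))).circleAverage_poissonKernel_smul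
      (c := 0) (R := 1) (w := a) (by simpa using ha)
    -- The shift by -π moves the angular interval to (-π, π), the one used by polar coordinates on
    -- ℂ.
    rw [Real.circleAverage_eq_integral_add (-Real.pi)] at h
    have h2 : ∀ θ : ℝ, (poissonKernel 0 a • fun _ => (1 : ℂ)) (circleMap 0 1 (θ + -Real.pi)) =
        ((1 - ‖a‖ ^ 2) * (1 / ‖Complex.exp (((θ + -Real.pi : ℝ) : ℂ) * Complex.I) - a‖ ^ 2)) •
          (1 : ℂ) := by
      intro θ
      simp only [Pi.smul_apply', poissonKernel_def, circleMap, sub_zero, zero_add,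
        Complex.ofReal_one, one_mul, Complex.norm_exp_ofReal_mul_I, one_pow]
      rw [mul_one_div]
    simp_rw [h2] at h
    rw [intervalIntegral.integral_smul_const, intervalIntegral.integral_const_mul, smul_smul,
      Complex.real_smul, mul_one, Complex.ofReal_eq_one] at h
    have h3 := (inv_mul_eq_one₀ Real.two_pi_pos.ne').1 h
    rw [eq_div_iff hpos.ne', mul_comm]
    exact h3.symm
  rw [restrict_Ioo_eq_restrict_Ioc, ← ofReal_integral_eq_lintegral_ofReal
    ((hcont.intervalIntegrable _ _).1) (.of_forall fun θ => by positivity),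
    ← intervalIntegral.integral_of_le (by linarith [Real.pi_pos]), ← hpois]
  rw [intervalIntegral.integral_comp_add_right
    (fun θ : ℝ => 1 / ‖Complex.exp ((θ : ℂ) * Complex.I) - a‖ ^ 2)]
  congr 2 <;> ring

/-- Split at u = a: convergence at 0 uses x < 1 and gives 1/(1-x); convergence at ∞ uses x > 0 and
gives 1/x. -/
theorem lintegral_radial {x a : ℝ} (hx0 : 0 < x) (hx1 : x < 1) (ha : 0 < a) :
    ∫⁻ u in Ioi (0 : ℝ), ENNReal.ofReal (u ^ (-x) / max a u) ≤
      ENNReal.ofReal ((1 / (1 - x) + 1 / x) * a ^ (-x)) := by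
  have hsplit : Ioi (0 : ℝ) = Ioc 0 a ∪ Ioi a := (Ioc_union_Ioi_eq_Ioi ha.le).symm
  have h1 : ∫⁻ u in Ioc 0 a, ENNReal.ofReal (u ^ (-x) / max a u) ≤
      ENNReal.ofReal (1 / (1 - x) * a ^ (-x)) := by
    have hi : IntervalIntegrable (fun u : ℝ => u ^ (-x) / a) volume 0 a :=
      (intervalIntegral.intervalIntegrable_rpow' (by linarith)).div_const _
    calc _ = ∫⁻ u in Ioc 0 a, ENNReal.ofReal (u ^ (-x) / a) :=
          setLIntegral_congr_fun measurableSet_Ioc fun u hu => by rw [max_eq_left hu.2]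
      _ = ENNReal.ofReal (∫ u in Ioc 0 a, u ^ (-x) / a) := by
          rw [ofReal_integral_eq_lintegral_ofReal hi.1]
          filter_upwards [ae_restrict_mem measurableSet_Ioc] with u hu
          have := hu.1
          positivity
      _ ≤ _ := by
          apply ENNReal.ofReal_le_ofReal
          rw [← intervalIntegral.integral_of_le ha.le, intervalIntegral.integral_div,
            integral_rpow (Or.inl (by linarith)), Real.zero_rpow (by linarith),
            Real.rpow_add ha, Real.rpow_one]
          apply le_of_eq
          have : 1 - x ≠ 0 := by linarith
          have : -x + 1 ≠ 0 := by linarith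
          field_simp
          ring
  have h2 : ∫⁻ u in Ioi a, ENNReal.ofReal (u ^ (-x) / max a u) ≤
      ENNReal.ofReal (1 / x * a ^ (-x)) := by
    have hi := integrableOn_Ioi_rpow_of_lt (a := -x - 1) (by linarith) ha
    calc _ = ∫⁻ u in Ioi a, ENNReal.ofReal (u ^ (-x - 1)) :=
          setLIntegral_congr_fun measurableSet_Ioi fun u (hu : a < u) => by
            rw [max_eq_right hu.le, Real.rpow_sub_one (ha.trans hu).ne']
      _ = ENNReal.ofReal (∫ u in Ioi a, u ^ (-x - 1)) := by
          rw [ofReal_integral_eq_lintegral_ofReal hi]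
          filter_upwards [ae_restrict_mem measurableSet_Ioi] with u hu
          have : 0 < u := ha.trans hu
          positivity
      _ ≤ _ := by
          apply ENNReal.ofReal_le_ofReal
          rw [integral_Ioi_rpow_of_lt (by linarith) ha]
          apply le_of_eq
          rw [sub_add_cancel]
          field_simp
  rw [hsplit, lintegral_union measurableSet_Ioi Ioc_disjoint_Ioi_same, add_mul,
    ENNReal.ofReal_add (by have : 0 < 1 - x := by linarith
                           positivity) (by positivity)]
  exact add_le_add h1 h2

theorem ae_norm_lt_one : ∀ᵐ w ∂diskMeasure, ‖w‖ < 1 := by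
  refine Measure.ae_smul_measure ?_ _
  filter_upwards [ae_restrict_mem Metric.isOpen_ball.measurableSet] with w hw
  simpa using hw

instance : IsFiniteMeasure diskMeasure := by
  constructor
  rw [diskMeasure, Measure.smul_apply, Measure.restrict_apply_univ, smul_eq_mul]
  exact ENNReal.mul_lt_top (by simp [Real.pi_pos]) measure_ball_lt_top

theorem norm_one_sub_mul_conj_comm (z w : ℂ) : ‖1 - z * conj w‖ = ‖1 - w * conj z‖ := by
  rw [← Complex.norm_conj]; simp [mul_comm]

theorem enorm_one_sub_mul_conj_comm (z w : ℂ) : ‖1 - z * conj w‖ₑ = ‖1 - w * conj z‖ₑ := by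
  rw [← ofReal_norm, ← ofReal_norm, norm_one_sub_mul_conj_comm]

theorem norm_mul_conj_lt_one {z w : ℂ} (hz : ‖z‖ < 1) (hw : ‖w‖ < 1) : ‖z * conj w‖ < 1 := by
  rw [norm_mul, Complex.norm_conj]
  nlinarith [norm_nonneg z, norm_nonneg w]

theorem norm_one_sub_mul_conj_pos {z w : ℂ} (hz : ‖z‖ < 1) (hw : ‖w‖ < 1) :
    0 < ‖1 - z * conj w‖ := by
  have := norm_sub_norm_le (1 : ℂ) (z * conj w)
  rw [norm_one] at this
  linarith [norm_mul_conj_lt_one hz hw]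

/-- The Forelli–Rudin estimate. -/
theorem lintegral_forelli_rudin {x : ℝ} (hx0 : 0 < x) (hx1 : x < 1) {z : ℂ} (hz : ‖z‖ < 1) :
    ∫⁻ w, ‖1 - z * conj w‖ₑ ^ (-2 : ℝ) * ENNReal.ofReal (1 - ‖w‖ ^ 2) ^ (-x) ∂diskMeasure ≤
      ENNReal.ofReal (2 * (1 / (1 - x) + 1 / x)) * ENNReal.ofReal (1 - ‖z‖ ^ 2) ^ (-x) := by
  have hz2 : 0 < 1 - ‖z‖ ^ 2 := by nlinarith [norm_nonneg z]
  set F : ℂ → ℝ≥0∞ := fun w =>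
    ‖1 - z * conj w‖ₑ ^ (-2 : ℝ) * ENNReal.ofReal (1 - ‖w‖ ^ 2) ^ (-x) with hF
  -- For w = ρ e^(iθ) one has |1 - z w̄| = |e^(iθ) - ρz|, which exposes the Poisson kernel at ρz;
  -- the Jacobian ρ is bounded by 1 and 1 - ρ² is replaced by 1 - ρ.
  have key : ∀ ρ ∈ Ioo (0 : ℝ) 1, ∀ θ : ℝ,
      ENNReal.ofReal ρ * F (Complex.polarCoord.symm (ρ, θ)) ≤
      ENNReal.ofReal ((1 - ρ) ^ (-x)) *
        ENNReal.ofReal (1 / ‖Complex.exp (θ * Complex.I) - ρ * z‖ ^ 2) := by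
    intro ρ hρ θ
    have hw : ‖Complex.polarCoord.symm (ρ, θ)‖ = ρ := by
      rw [Complex.norm_polarCoord_symm, abs_of_pos hρ.1]
    have hn : ‖1 - z * conj (Complex.polarCoord.symm (ρ, θ))‖ =
        ‖Complex.exp (θ * Complex.I) - ρ * z‖ := by
      have h1 : Complex.polarCoord.symm (ρ, θ) = ρ * Complex.exp (θ * Complex.I) := by
        rw [Complex.exp_mul_I]; simp
      have h2 : conj (Complex.exp (θ * Complex.I)) * Complex.exp (θ * Complex.I) = 1 := by
        rw [← Complex.exp_conj, ← Complex.exp_add]; simp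
      have h3 : 1 - z * conj (Complex.polarCoord.symm (ρ, θ)) =
          conj (Complex.exp (θ * Complex.I)) * (Complex.exp (θ * Complex.I) - ρ * z) := by
        rw [h1, mul_sub, h2, map_mul, Complex.conj_ofReal]; ring
      rw [h3, norm_mul, Complex.norm_conj, Complex.norm_exp_ofReal_mul_I, one_mul]
    have hpos := norm_one_sub_mul_conj_pos hz (hw.trans_lt hρ.2)
    have h1 : 0 < 1 - ρ := by linarith [hρ.2]
    have h2 : 1 - ρ ≤ 1 - ρ ^ 2 := by nlinarith [hρ.1, hρ.2]
    rw [hF]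
    simp only
    rw [hw, ← ofReal_norm, hn, ENNReal.ofReal_rpow_of_pos (hn ▸ hpos),
      ENNReal.ofReal_rpow_of_pos (h1.trans_le h2), ← ENNReal.ofReal_mul (by positivity),
      ← ENNReal.ofReal_mul hρ.1.le, ← ENNReal.ofReal_mul (by positivity)]
    apply ENNReal.ofReal_le_ofReal
    have h3 : (1 - ρ ^ 2) ^ (-x) ≤ (1 - ρ) ^ (-x) :=
      Real.rpow_le_rpow_of_nonpos h1 h2 (by linarith)
    have h4 : ‖Complex.exp (θ * Complex.I) - ρ * z‖ ^ (-2 : ℝ) =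
        1 / ‖Complex.exp (θ * Complex.I) - ρ * z‖ ^ 2 := by
      rw [Real.rpow_neg (norm_nonneg _), one_div]; norm_cast
    rw [h4, mul_comm ((1 - ρ) ^ (-x)), ← mul_assoc]
    have h5 : 0 ≤ (1 - ρ ^ 2) ^ (-x) := by
      apply Real.rpow_nonneg; linarith
    calc _ ≤ 1 * (1 / ‖Complex.exp (θ * Complex.I) - ρ * z‖ ^ 2) * (1 - ρ) ^ (-x) := by
          gcongr
          exact hρ.2.le
      _ = _ := by ring
  have hinner : ∀ ρ ∈ Ioo (0 : ℝ) 1,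
      ∫⁻ θ in Ioo (-Real.pi) Real.pi, ENNReal.ofReal ((1 - ρ) ^ (-x)) *
        ENNReal.ofReal (1 / ‖Complex.exp (θ * Complex.I) - ρ * z‖ ^ 2) ≤
      ENNReal.ofReal (2 * Real.pi) *
        ENNReal.ofReal ((1 - ρ) ^ (-x) / max (1 - ‖z‖ ^ 2) (1 - ρ)) := by
    intro ρ hρ
    have h1 : 0 < 1 - ρ := by linarith [hρ.2]
    have hn : ‖(ρ : ℂ) * z‖ = ρ * ‖z‖ := by
      rw [norm_mul, Complex.norm_real, Real.norm_of_nonneg hρ.1.le]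
    rw [lintegral_const_mul' _ _ ENNReal.ofReal_ne_top,
      lintegral_poisson (by rw [hn]; nlinarith [hρ.1, hρ.2, norm_nonneg z]),
      ← ENNReal.ofReal_mul (by positivity), ← ENNReal.ofReal_mul (by positivity)]
    apply ENNReal.ofReal_le_ofReal
    -- This turns the Poisson factor 1/(1 - ρ²|z|²) into the form handled by `lintegral_radial` with
    -- a = 1 - |z|².
    have : max (1 - ‖z‖ ^ 2) (1 - ρ) ≤ 1 - ‖(ρ : ℂ) * z‖ ^ 2 := by
      rw [hn, mul_pow]
      have : ρ ^ 2 ≤ ρ := by nlinarith [hρ.1, hρ.2]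
      apply max_le <;> nlinarith [hρ.1, hρ.2, sq_nonneg ‖z‖, sq_nonneg ρ]
    rw [mul_div_assoc', mul_comm _ (2 * Real.pi), ← mul_div_assoc]
    exact div_le_div_of_nonneg_left (by positivity) (lt_max_of_lt_right h1) this
  have hmeasF : Measurable F := by fun_prop
  have hsub : ∫⁻ w in Metric.ball (0 : ℂ) 1, F w ≤
      ENNReal.ofReal (2 * Real.pi) * ∫⁻ ρ in Ioo (0 : ℝ) 1,
        ENNReal.ofReal ((1 - ρ) ^ (-x) / max (1 - ‖z‖ ^ 2) (1 - ρ)) := by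
    rw [← lintegral_indicator Metric.isOpen_ball.measurableSet,
      ← Complex.lintegral_comp_polarCoord_symm, polarCoord_target,
      Measure.volume_eq_prod, setLIntegral_prod _ (by
        refine (measurable_fst.ennreal_ofReal.mul ?_).aemeasurable
        exact (hmeasF.indicator Metric.isOpen_ball.measurableSet).comp
          (show Measurable fun p : ℝ × ℝ => Complex.polarCoord.symm p by
            simp only [Complex.polarCoord_symm_apply]; fun_prop)),
      ← lintegral_const_mul' _ _ ENNReal.ofReal_ne_top, show Ioo (0 : ℝ) 1 = Iio 1 ∩ Ioi 0 by
        rw [inter_comm, Ioi_inter_Iio],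
      ← setLIntegral_indicator measurableSet_Iio]
    refine setLIntegral_mono' measurableSet_Ioi fun ρ (hρ : 0 < ρ) => ?_
    have hw : ∀ θ, ‖Complex.polarCoord.symm (ρ, θ)‖ = ρ := fun θ => by
      rw [Complex.norm_polarCoord_symm, abs_of_pos hρ]
    by_cases h : ρ < 1
    · rw [indicator_of_mem (by exact h)]
      refine le_trans (lintegral_mono fun θ => ?_) (hinner ρ ⟨hρ, h⟩)
      rw [indicator_of_mem (by rw [mem_ball_zero_iff, hw]; exact h)]
      exact key ρ ⟨hρ, h⟩ θ
    · rw [indicator_of_notMem (by exact h), nonpos_iff_eq_zero]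
      refine lintegral_eq_zero_of_ae_eq_zero (.of_forall fun θ => ?_)
      simp only
      rw [indicator_of_notMem (by rw [mem_ball_zero_iff, hw]; exact h), smul_zero, Pi.zero_apply]
  have hshift : ∫⁻ ρ in Ioo (0 : ℝ) 1,
        ENNReal.ofReal ((1 - ρ) ^ (-x) / max (1 - ‖z‖ ^ 2) (1 - ρ)) ≤
      ∫⁻ u in Ioi (0 : ℝ), ENNReal.ofReal (u ^ (-x) / max (1 - ‖z‖ ^ 2) u) := by
    rw [← lintegral_indicator measurableSet_Ioi, ← lintegral_indicator measurableSet_Ioo,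
      ← lintegral_sub_left_eq_self _ (1 : ℝ)]
    refine lintegral_mono fun ρ => ?_
    by_cases h : 1 - ρ ∈ Ioo (0 : ℝ) 1
    · rw [indicator_of_mem h, indicator_of_mem (by simpa using h.2), sub_sub_cancel]
    · rw [indicator_of_notMem h]
      exact zero_le
  have hrad := hshift.trans (lintegral_radial hx0 hx1 hz2)
  rw [diskMeasure, lintegral_smul_measure, smul_eq_mul]
  calc _ ≤ (ENNReal.ofReal Real.pi)⁻¹ * (ENNReal.ofReal (2 * Real.pi) *
        ENNReal.ofReal ((1 / (1 - x) + 1 / x) * (1 - ‖z‖ ^ 2) ^ (-x))) := by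
        gcongr
        exact hsub.trans (by gcongr)
    _ = _ := by
      have : 0 < 1 - x := by linarith
      rw [ENNReal.ofReal_rpow_of_pos hz2, ← ENNReal.ofReal_inv_of_pos Real.pi_pos,
        ← ENNReal.ofReal_mul (by positivity), ← ENNReal.ofReal_mul (by positivity),
        ← ENNReal.ofReal_mul (by positivity)]
      congr 1
      have := Real.pi_ne_zero
      field_simp

/-! ### The Schur test and the potential operator. -/

/-- Jensen's inequality for the unnormalised measure F dμ, obtained from Hölder with exponents 1/r
and 1 - 1/r. -/
theorem lintegral_mul_rpow_le {α : Type*} [MeasurableSpace α] {μ : Measure α} {r : ℝ}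
    (hr : 1 ≤ r) {g F : α → ℝ≥0∞} (hg : AEMeasurable g μ) (hF : AEMeasurable F μ) :
    (∫⁻ a, g a * F a ∂μ) ^ r ≤ (∫⁻ a, g a ^ r * F a ∂μ) * (∫⁻ a, F a ∂μ) ^ (r - 1) := by
  have hr0 : 0 < r := by linarith
  have h1 : 0 ≤ 1 - 1 / r := by rw [sub_nonneg, div_le_one hr0]; exact hr
  have h := ENNReal.lintegral_mul_norm_pow_le (μ := μ) (f := fun a => g a ^ r * F a) (g := F)
    ((hg.pow_const r).mul hF) hF (one_div_nonneg.2 hr0.le) h1 (by ring)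
  have h2 : ∀ a, (g a ^ r * F a) ^ (1 / r) * F a ^ (1 - 1 / r) = g a * F a := fun a => by
    rw [ENNReal.mul_rpow_of_nonneg _ _ (by positivity), ← ENNReal.rpow_mul,
      mul_one_div_cancel hr0.ne', ENNReal.rpow_one, mul_assoc,
      ← ENNReal.rpow_add_of_nonneg _ _ (by positivity) h1, add_sub_cancel, ENNReal.rpow_one]
  simp_rw [h2] at h
  refine (ENNReal.rpow_le_rpow h hr0.le).trans_eq ?_
  rw [ENNReal.mul_rpow_of_nonneg _ _ hr0.le, ← ENNReal.rpow_mul, ← ENNReal.rpow_mul,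
    one_div_mul_cancel hr0.ne', ENNReal.rpow_one]
  congr 2
  field_simp

/-- A Schur test for boundedness from `L^p` to `L^q`, with kernel `k₁ * k₂`. -/
theorem lintegral_schur {α : Type*} [MeasurableSpace α] {μ : Measure α} [SFinite μ]
    {p p' q : ℝ} (hpp : p.HolderConjugate p') (hpq : p ≤ q) {k₁ k₂ : α → α → ℝ≥0∞}
    (hk₁ : Measurable (Function.uncurry k₁)) (hk₂ : Measurable (Function.uncurry k₂))
    {h : α → ℝ≥0∞} (hm : Measurable h) (h0 : ∀ᵐ w ∂μ, h w ≠ 0 ∧ h w ≠ ∞) {C₁ C₂ : ℝ≥0∞}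
    (H₁ : ∀ᵐ z ∂μ, ∫⁻ w, k₁ z w ^ p' * h w ^ p' ∂μ ≤ C₁ * h z ^ p')
    (H₂ : ∀ᵐ w ∂μ, ∫⁻ z, k₂ z w ^ q * h z ^ q ∂μ ≤ C₂ * h w ^ q)
    {f : α → ℝ≥0∞} (hf : AEMeasurable f μ) :
    ∫⁻ z, (∫⁻ w, k₁ z w * k₂ z w * f w ∂μ) ^ q ∂μ ≤
      C₁ ^ (q / p') * C₂ * (∫⁻ w, f w ^ p ∂μ) ^ (q / p) := by
  have hp := hpp.pos
  have hp' := hpp.symm.pos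
  have hq : 0 < q := hp.trans_le hpq
  have hk₁z : ∀ z, Measurable (k₁ z) := fun z => hk₁.comp measurable_prodMk_left
  have hk₂z : ∀ z, Measurable (k₂ z) := fun z => hk₂.comp measurable_prodMk_left
  -- Hölder applied to (k₁ h)(k₂ h⁻¹ f) disposes of k₁ through `H₁`. The remaining power q/p ≥ 1 is
  -- moved inside the integral by Jensen against f^p dμ; Tonelli and `H₂` then finish.
  have hpt : ∀ᵐ z ∂μ, (∫⁻ w, k₁ z w * k₂ z w * f w ∂μ) ^ q ≤
      C₁ ^ (q / p') * (∫⁻ w, f w ^ p ∂μ) ^ (q / p - 1) *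
        ∫⁻ w, h z ^ q * (k₂ z w ^ q * ((h w)⁻¹ ^ q * f w ^ p)) ∂μ := by
    filter_upwards [H₁] with z hz
    have e1 : ∫⁻ w, k₁ z w * k₂ z w * f w ∂μ =
        ∫⁻ w, (k₁ z w * h w) * (k₂ z w * (h w)⁻¹ * f w) ∂μ := by
      refine lintegral_congr_ae ?_
      filter_upwards [h0] with w hw
      calc _ = k₁ z w * k₂ z w * f w * (h w * (h w)⁻¹) := by
            rw [ENNReal.mul_inv_cancel hw.1 hw.2, mul_one]
        _ = _ := by ring
    have e2 : ∫⁻ w, (k₁ z w * h w) * (k₂ z w * (h w)⁻¹ * f w) ∂μ ≤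
        (∫⁻ w, (k₁ z w * h w) ^ p' ∂μ) ^ (1 / p') *
          (∫⁻ w, (k₂ z w * (h w)⁻¹ * f w) ^ p ∂μ) ^ (1 / p) :=
      ENNReal.lintegral_mul_le_Lp_mul_Lq μ hpp.symm
        ((hk₁z z).mul hm).aemeasurable
        (((hk₂z z).mul hm.inv).aemeasurable.mul hf)
    have e3 : ∫⁻ w, (k₁ z w * h w) ^ p' ∂μ ≤ C₁ * h z ^ p' := by
      simpa only [ENNReal.mul_rpow_of_nonneg _ _ hp'.le] using hz
    have e4 : ∫⁻ w, (k₂ z w * (h w)⁻¹ * f w) ^ p ∂μ =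
        ∫⁻ w, (k₂ z w * (h w)⁻¹) ^ p * f w ^ p ∂μ := by
      simp_rw [ENNReal.mul_rpow_of_nonneg _ _ hp.le]
    have e5 := lintegral_mul_rpow_le (μ := μ) (r := q / p) ((one_le_div hp).2 hpq)
      (g := fun w => (k₂ z w * (h w)⁻¹) ^ p) (F := fun w => f w ^ p)
      (((hk₂z z).mul hm.inv).pow_const p).aemeasurable (hf.pow_const p)
    rw [e1]
    calc _ ≤ ((C₁ * h z ^ p') ^ (1 / p') *
          (∫⁻ w, (k₂ z w * (h w)⁻¹) ^ p * f w ^ p ∂μ) ^ (1 / p)) ^ q := by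
          rw [← e4]
          gcongr
          exact e2.trans (by gcongr)
      _ = C₁ ^ (q / p') * h z ^ q *
          (∫⁻ w, (k₂ z w * (h w)⁻¹) ^ p * f w ^ p ∂μ) ^ (q / p) := by
          rw [ENNReal.mul_rpow_of_nonneg _ _ hq.le, ← ENNReal.rpow_mul, ← ENNReal.rpow_mul,
            ENNReal.mul_rpow_of_nonneg _ _ (by positivity), ← ENNReal.rpow_mul,
            one_div_mul_eq_div, one_div_mul_eq_div, mul_div_cancel₀ _ hp'.ne']
      _ ≤ C₁ ^ (q / p') * h z ^ q *
          ((∫⁻ w, ((k₂ z w * (h w)⁻¹) ^ p) ^ (q / p) * f w ^ p ∂μ) *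
            (∫⁻ w, f w ^ p ∂μ) ^ (q / p - 1)) := by gcongr
      _ = C₁ ^ (q / p') * (∫⁻ w, f w ^ p ∂μ) ^ (q / p - 1) *
          (h z ^ q * ∫⁻ w, k₂ z w ^ q * ((h w)⁻¹ ^ q * f w ^ p) ∂μ) := by
          simp_rw [← ENNReal.rpow_mul, mul_div_cancel₀ _ hp.ne',
            ENNReal.mul_rpow_of_nonneg _ _ hq.le, mul_assoc]
          ring
      _ = _ := by
          rw [lintegral_const_mul'']
          exact ((hk₂z z).pow_const q).aemeasurable.mul
            ((hm.inv.pow_const q).aemeasurable.mul (hf.pow_const p))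
  have hmeas : AEMeasurable (Function.uncurry fun z w =>
      h z ^ q * (k₂ z w ^ q * ((h w)⁻¹ ^ q * f w ^ p))) (μ.prod μ) := by
    refine ((hm.comp measurable_fst).pow_const q).aemeasurable.mul
      ((hk₂.pow_const q).aemeasurable.mul
        (((hm.comp measurable_snd).inv.pow_const q).aemeasurable.mul
          ((hf.comp_snd).pow_const p)))
  calc _ ≤ ∫⁻ z, C₁ ^ (q / p') * (∫⁻ w, f w ^ p ∂μ) ^ (q / p - 1) *
        ∫⁻ w, h z ^ q * (k₂ z w ^ q * ((h w)⁻¹ ^ q * f w ^ p)) ∂μ ∂μ :=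
        lintegral_mono_ae hpt
    _ = C₁ ^ (q / p') * (∫⁻ w, f w ^ p ∂μ) ^ (q / p - 1) *
        ∫⁻ w, ∫⁻ z, h z ^ q * (k₂ z w ^ q * ((h w)⁻¹ ^ q * f w ^ p)) ∂μ ∂μ := by
        rw [← lintegral_lintegral_swap hmeas, lintegral_const_mul'']
        exact hmeas.lintegral_prod_right'
    _ ≤ C₁ ^ (q / p') * (∫⁻ w, f w ^ p ∂μ) ^ (q / p - 1) * ∫⁻ w, C₂ * f w ^ p ∂μ := by
        gcongr 1
        refine lintegral_mono_ae ?_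
        filter_upwards [H₂, h0] with w hw hw0
        have : ∀ z, h z ^ q * (k₂ z w ^ q * ((h w)⁻¹ ^ q * f w ^ p)) =
            (k₂ z w ^ q * h z ^ q) * ((h w)⁻¹ ^ q * f w ^ p) := fun z => by ring
        simp_rw [this]
        rw [lintegral_mul_const _ (by
          exact ((hk₂.comp measurable_prodMk_right).pow_const q).mul (hm.pow_const q))]
        calc _ ≤ C₂ * h w ^ q * ((h w)⁻¹ ^ q * f w ^ p) := by gcongr
          _ = C₂ * f w ^ p * (h w * (h w)⁻¹) ^ q := by
            rw [ENNReal.mul_rpow_of_nonneg _ _ hq.le]; ring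
          _ = _ := by rw [ENNReal.mul_inv_cancel hw0.1 hw0.2, ENNReal.one_rpow, mul_one]
    _ = C₁ ^ (q / p') * C₂ * ((∫⁻ w, f w ^ p ∂μ) ^ (q / p - 1) * (∫⁻ w, f w ^ p ∂μ) ^ (1 : ℝ)) := by
        rw [lintegral_const_mul'' _ (hf.pow_const p), ENNReal.rpow_one]; ring
    _ = _ := by
        rw [← ENNReal.rpow_add_of_nonneg _ _ (sub_nonneg.2 ((one_le_div hp).2 hpq)) zero_le_one,
          sub_add_cancel]

/-- Boundedness from `L^p` to `L^q` of the positive operator with kernel `|1 - z w̄| ^ (-2 / c)`. -/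
theorem lintegral_potential_le {p q c : ℝ} (hp : 1 < p) (hpq : p ≤ q)
    (hc : 1 / q = 1 / p + 1 / c - 1) :
    ∃ C : ℝ≥0, ∀ f : ℂ → ℝ≥0∞, AEMeasurable f diskMeasure →
      ∫⁻ z, (∫⁻ w, ‖1 - z * conj w‖ₑ ^ (-(2 / c)) * f w ∂diskMeasure) ^ q ∂diskMeasure ≤
        C * (∫⁻ w, f w ^ p ∂diskMeasure) ^ (q / p) := by
  have hpp := Real.HolderConjugate.conjExponent hp
  set p' := Real.conjExponent p
  have hp' : 0 < p' := hpp.symm.pos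
  have hq : 0 < q := by linarith
  -- Forelli–Rudin is used with exponents s p' and s q, so both must lie in (0,1).
  obtain ⟨s, hs0, hs⟩ : ∃ s : ℝ, 0 < s ∧ s < min (1 / p') (1 / q) :=
    exists_between (by positivity)
  have hsp : s * p' < 1 := (lt_div_iff₀ hp').1 (hs.trans_le (min_le_left _ _))
  have hsq : s * q < 1 := (lt_div_iff₀ hq).1 (hs.trans_le (min_le_right _ _))
  set C₁ : ℝ≥0∞ := ENNReal.ofReal (2 * (1 / (1 - s * p') + 1 / (s * p')))
  set C₂ : ℝ≥0∞ := ENNReal.ofReal (2 * (1 / (1 - s * q) + 1 / (s * q)))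
  have hC : C₁ ^ (q / p') * C₂ ≠ ∞ :=
    ENNReal.mul_ne_top (ENNReal.rpow_ne_top_of_nonneg (by positivity) ENNReal.ofReal_ne_top)
      ENNReal.ofReal_ne_top
  refine ⟨(C₁ ^ (q / p') * C₂).toNNReal, fun f hf => ?_⟩
  rw [ENNReal.coe_toNNReal hC]
  have hpow : ∀ a : ℝ, 0 < a → ∀ x : ℝ≥0∞, (x ^ (-(2 / a))) ^ a = x ^ (-2 : ℝ) := fun a ha x => by
    rw [← ENNReal.rpow_mul, neg_mul, div_mul_cancel₀ _ ha.ne']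
  have hpow' : ∀ a : ℝ, ∀ x : ℝ≥0∞, (x ^ (-s)) ^ a = x ^ (-(s * a)) := fun a x => by
    rw [← ENNReal.rpow_mul, neg_mul]
  have hsch := lintegral_schur (μ := diskMeasure) hpp hpq
    (k₁ := fun z w => ‖1 - z * conj w‖ₑ ^ (-(2 / p')))
    (k₂ := fun z w => ‖1 - z * conj w‖ₑ ^ (-(2 / q)))
    (h := fun w => ENNReal.ofReal (1 - ‖w‖ ^ 2) ^ (-s)) (C₁ := C₁) (C₂ := C₂)
    (by fun_prop) (by fun_prop) (by fun_prop) ?_ ?_ ?_ hf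
  · refine le_trans (lintegral_mono_ae ?_) hsch
    filter_upwards [ae_norm_lt_one] with z hz
    gcongr 1
    refine lintegral_mono_ae ?_
    filter_upwards [ae_norm_lt_one] with w hw
    have hpos := norm_one_sub_mul_conj_pos hz hw
    -- The relation between p, q and c is exactly what makes k₁^p' and k₂^q both equal to |1 - z
    -- w̄|^(-2).
    have hcc : -(2 / c) = -(2 / p') + -(2 / q) := by
      have h1 := hpp.inv_add_inv_eq_one
      simp only [one_div] at hc
      simp only [div_eq_mul_inv]
      linear_combination 2 * hc + 2 * h1
    rw [hcc, ENNReal.rpow_add _ _ (by simpa using hpos) enorm_ne_top]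
  · filter_upwards [ae_norm_lt_one] with w hw
    have : 0 < 1 - ‖w‖ ^ 2 := by nlinarith [norm_nonneg w]
    rw [ENNReal.ofReal_rpow_of_pos this]
    exact ⟨by simpa using Real.rpow_pos_of_pos this _, ENNReal.ofReal_ne_top⟩
  · filter_upwards [ae_norm_lt_one] with z hz
    simp_rw [hpow _ hp', hpow']
    exact lintegral_forelli_rudin (by positivity) hsp hz
  · filter_upwards [ae_norm_lt_one] with w hw
    simp_rw [hpow _ hq, hpow', enorm_one_sub_mul_conj_comm _ w]
    exact lintegral_forelli_rudin (by positivity) hsq hw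

end Shimorin

/-! ### Kernel size and the strong-type bound. -/

noncomputable section

namespace Shimorin

/-- The Stieltjes-type transform `∫ 1 / (1 - r + t) dν(r)`, which governs the size of the kernel
at distance `t` from the diagonal of the circle. -/
def growth (ν : Measure (Icc (0 : ℝ) 1)) (t : ℝ) : ℝ :=
  ∫ r : Icc (0 : ℝ) 1, 1 / (1 - (r : ℝ) + t) ∂ν

variable (ν : Measure (Icc (0 : ℝ) 1))

theorem integrable_growth [IsFiniteMeasure ν] {t : ℝ} (ht : 0 < t) :
    Integrable (fun r : Icc (0 : ℝ) 1 => 1 / (1 - (r : ℝ) + t)) ν := by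
  refine Integrable.of_bound (C := 1 / t)
    (Measurable.aestronglyMeasurable (by fun_prop)) (.of_forall fun r => ?_)
  have := r.2.2
  rw [Real.norm_of_nonneg (one_div_nonneg.2 (by linarith))]
  exact one_div_le_one_div_of_le ht (by linarith)

theorem growth_nonneg {t : ℝ} (ht : 0 ≤ t) : 0 ≤ growth ν t :=
  integral_nonneg fun r => one_div_nonneg.2 (by linarith [r.2.2])

theorem growth_antitone [IsFiniteMeasure ν] {s t : ℝ} (hs : 0 < s) (hst : s ≤ t) :
    growth ν t ≤ growth ν s := by
  refine integral_mono (integrable_growth ν (hs.trans_le hst)) (integrable_growth ν hs) fun r => ?_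
  exact one_div_le_one_div_of_le (by linarith [r.2.2]) (by linarith)

/-- Since |1 - ζ| ≤ |1 - rζ| + (1 - r), the left side is at most |1 - rζ| + 2(1 - r), and 1 - r ≤ |1
- rζ|. -/
theorem le_three_mul_norm_one_sub {ζ : ℂ} (hζ : ‖ζ‖ < 1) {r : ℝ} (hr : r ∈ Icc (0 : ℝ) 1) :
    1 - r + ‖1 - ζ‖ ≤ 3 * ‖1 - r * ζ‖ := by
  have h1 : 1 - r ≤ ‖1 - r * ζ‖ := by
    have := norm_sub_norm_le (1 : ℂ) (r * ζ)
    rw [norm_one, norm_mul, Complex.norm_real, Real.norm_of_nonneg hr.1] at this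
    nlinarith [hr.1, norm_nonneg ζ]
  have h2 : ‖1 - ζ‖ ≤ ‖1 - r * ζ‖ + (1 - r) := by
    have e : 1 - ζ = (1 - r * ζ) - ((1 - r : ℝ) : ℂ) * ζ := by push_cast; ring
    have h3 := norm_sub_le (1 - r * ζ) (((1 - r : ℝ) : ℂ) * ζ)
    rw [← e, norm_mul, Complex.norm_real, Real.norm_of_nonneg (sub_nonneg.2 hr.2)] at h3
    nlinarith [hr.2, norm_nonneg ζ]
  linarith

theorem norm_one_sub_mul_pos {ζ : ℂ} (hζ : ‖ζ‖ < 1) {r : ℝ} (hr : r ∈ Icc (0 : ℝ) 1) :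
    0 < ‖1 - r * ζ‖ := by
  have h1 := le_three_mul_norm_one_sub hζ hr
  have h2 : 0 < ‖1 - ζ‖ := by
    have := norm_sub_norm_le (1 : ℂ) ζ
    rw [norm_one] at this
    linarith
  linarith [hr.2]

theorem norm_inner_kernel_le {ζ : ℂ} (hζ : ‖ζ‖ < 1) {r : ℝ} (hr : r ∈ Icc (0 : ℝ) 1) :
    ‖1 / (1 - r * ζ)‖ ≤ 3 * (1 / (1 - r + ‖1 - ζ‖)) := by
  have h1 := norm_one_sub_mul_pos hζ hr
  have h2 : 0 < ‖1 - ζ‖ := by simpa using norm_one_sub_mul_pos hζ (r := 1) (by simp)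
  rw [norm_div, norm_one, mul_one_div, div_le_div_iff₀ h1 (by linarith [hr.2]), one_mul]
  exact le_three_mul_norm_one_sub hζ hr

theorem kernel_eq (z w : ℂ) : kernel ν z w =
    1 / (1 - z * conj w) * ∫ r : Icc (0 : ℝ) 1, 1 / (1 - ((r : ℝ) : ℂ) * (z * conj w)) ∂ν := by
  simp only [kernel, mul_assoc]

theorem norm_kernel_le [IsFiniteMeasure ν] {z w : ℂ} (hz : ‖z‖ < 1) (hw : ‖w‖ < 1) :
    ‖kernel ν z w‖ ≤ 3 * growth ν ‖1 - z * conj w‖ / ‖1 - z * conj w‖ := by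
  have hζ := norm_mul_conj_lt_one hz hw
  have hpos := norm_one_sub_mul_conj_pos hz hw
  have h : ‖∫ r : Icc (0 : ℝ) 1, 1 / (1 - ((r : ℝ) : ℂ) * (z * conj w)) ∂ν‖ ≤
      3 * growth ν ‖1 - z * conj w‖ := by
    rw [growth, ← integral_const_mul]
    exact norm_integral_le_of_norm_le ((integrable_growth ν hpos).const_mul 3)
      (.of_forall fun r => norm_inner_kernel_le hζ r.2)
  rw [kernel_eq, norm_mul, norm_div, norm_one, one_div_mul_eq_div]
  gcongr

theorem stronglyMeasurable_kernel [IsFiniteMeasure ν] :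
    StronglyMeasurable (Function.uncurry (kernel ν)) := by
  have h : StronglyMeasurable fun p : ℂ × ℂ =>
      ∫ r : Icc (0 : ℝ) 1, 1 / (1 - ((r : ℝ) : ℂ) * p.1 * conj p.2) ∂ν := by
    refine StronglyMeasurable.integral_prod_right
      (f := fun (p : ℂ × ℂ) (r : Icc (0 : ℝ) 1) => 1 / (1 - ((r : ℝ) : ℂ) * p.1 * conj p.2)) ?_
    exact Measurable.stronglyMeasurable (by unfold Function.uncurry; fun_prop)
  have h2 : StronglyMeasurable fun p : ℂ × ℂ => 1 / (1 - p.1 * conj p.2) :=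
    Measurable.stronglyMeasurable (by fun_prop)
  exact h2.mul h

theorem aestronglyMeasurable_T [IsFiniteMeasure ν] {f : ℂ → ℂ}
    (hf : AEStronglyMeasurable f diskMeasure) : AEStronglyMeasurable (T ν f) diskMeasure :=
  AEStronglyMeasurable.integral_prod_right'
    (f := fun p : ℂ × ℂ => kernel ν p.1 p.2 * f p.2)
    ((stronglyMeasurable_kernel ν).aestronglyMeasurable.mul hf.comp_snd)

theorem enorm_kernel_le [IsFiniteMeasure ν] {b C : ℝ}
    (hC : ∀ t ∈ Ioc (0 : ℝ) 1, growth ν t ≤ C * t ^ (1 - b)) {z w : ℂ}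
    (hz : ‖z‖ < 1) (hw : ‖w‖ < 1) :
    ‖kernel ν z w‖ₑ ≤ ENNReal.ofReal (3 * C * 2⁻¹ ^ (1 - b)) * ‖1 - z * conj w‖ₑ ^ (-b) := by
  have hpos := norm_one_sub_mul_conj_pos hz hw
  set δ := ‖1 - z * conj w‖
  have h2 : δ ≤ 2 := by
    refine (norm_sub_le _ _).trans ?_
    rw [norm_one]
    linarith [norm_mul_conj_lt_one hz hw]
  -- δ ranges up to 2 while the growth bound is assumed only on (0,1]; monotonicity allows
  -- evaluation at δ/2.
  have h3 := growth_antitone ν (s := δ / 2) (t := δ) (by positivity) (by linarith)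
  have h4 := hC (δ / 2) ⟨by positivity, by linarith⟩
  rw [← ofReal_norm, ← ofReal_norm, ENNReal.ofReal_rpow_of_pos hpos,
    ← ENNReal.ofReal_mul' (by positivity)]
  apply ENNReal.ofReal_le_ofReal
  calc _ ≤ 3 * growth ν δ / δ := norm_kernel_le ν hz hw
    _ ≤ 3 * (C * (δ / 2) ^ (1 - b)) / δ := by
        gcongr
        exact h3.trans h4
    _ = _ := by
        rw [div_eq_mul_inv δ 2, Real.mul_rpow hpos.le (by norm_num), sub_eq_neg_add 1 b,
          Real.rpow_add_one hpos.ne']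
        field_simp

theorem strongType_of_growth_le [IsFiniteMeasure ν] {p q c C : ℝ} (hp : 1 < p) (hpq : p ≤ q)
    (hc : 1 / q = 1 / p + 1 / c - 1)
    (hC : ∀ t ∈ Ioc (0 : ℝ) 1, growth ν t ≤ C * t ^ (1 - 2 / c)) :
    StrongType (T ν) p q := by
  have hp0 : 0 < p := by linarith
  have hq : 0 < q := by linarith
  obtain ⟨A, hA⟩ := lintegral_potential_le hp hpq hc
  set K : ℝ≥0∞ := ENNReal.ofReal (3 * C * 2⁻¹ ^ (1 - 2 / c)) with hK
  have hB : K * (A : ℝ≥0∞) ^ (1 / q) ≠ ∞ := ENNReal.mul_ne_top ENNReal.ofReal_ne_top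
    (ENNReal.rpow_ne_top_of_nonneg (by positivity) ENNReal.coe_ne_top)
  have key : ∀ f : ℂ → ℂ, MemLp f (ENNReal.ofReal p) diskMeasure →
      eLpNorm (T ν f) (ENNReal.ofReal q) diskMeasure ≤
        K * (A : ℝ≥0∞) ^ (1 / q) * eLpNorm f (ENNReal.ofReal p) diskMeasure := by
    intro f hf
    have hpt : ∀ᵐ z ∂diskMeasure, ‖T ν f z‖ₑ ^ q ≤ K ^ q *
        (∫⁻ w, ‖1 - z * conj w‖ₑ ^ (-(2 / c)) * ‖f w‖ₑ ∂diskMeasure) ^ q := by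
      filter_upwards [ae_norm_lt_one] with z hz
      rw [← ENNReal.mul_rpow_of_nonneg _ _ hq.le, ← lintegral_const_mul' _ _ ENNReal.ofReal_ne_top]
      gcongr
      refine (enorm_integral_le_lintegral_enorm _).trans (lintegral_mono_ae ?_)
      filter_upwards [ae_norm_lt_one] with w hw
      rw [enorm_mul, ← mul_assoc]
      gcongr
      exact enorm_kernel_le ν hC hz hw
    rw [eLpNorm_eq_lintegral_rpow_enorm_toReal (by simpa using hq) ENNReal.ofReal_ne_top,
      eLpNorm_eq_lintegral_rpow_enorm_toReal (by simpa using hp0) ENNReal.ofReal_ne_top,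
      ENNReal.toReal_ofReal hq.le, ENNReal.toReal_ofReal hp0.le]
    calc _ ≤ (K ^ q * (A * (∫⁻ w, ‖f w‖ₑ ^ p ∂diskMeasure) ^ (q / p))) ^ (1 / q) := by
          gcongr
          refine (lintegral_mono_ae hpt).trans ?_
          rw [lintegral_const_mul' _ _
            (ENNReal.rpow_ne_top_of_nonneg hq.le ENNReal.ofReal_ne_top)]
          gcongr
          exact hA _ hf.1.enorm
      _ = _ := by
          rw [ENNReal.mul_rpow_of_nonneg _ _ (by positivity),
            ENNReal.mul_rpow_of_nonneg _ _ (by positivity), ← ENNReal.rpow_mul,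
            ← ENNReal.rpow_mul, mul_one_div_cancel hq.ne', ENNReal.rpow_one, mul_assoc]
          congr 3
          field_simp
  refine ⟨(K * (A : ℝ≥0∞) ^ (1 / q)).toNNReal, fun f hf => ?_⟩
  rw [ENNReal.coe_toNNReal hB]
  exact ⟨⟨aestronglyMeasurable_T ν hf.1,
    (key f hf).trans_lt (ENNReal.mul_lt_top hB.lt_top hf.2)⟩, key f hf⟩

theorem weakNorm_le_eLpNorm {f : ℂ → ℂ} {q : ℝ} (hq : 0 < q)
    (hf : AEStronglyMeasurable f diskMeasure) :
    weakNorm f q ≤ eLpNorm f (ENNReal.ofReal q) diskMeasure := by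
  -- Working with every C strictly above the norm supplies the positivity required in the infimum,
  -- even when the norm is 0. The rest is Chebyshev.
  refine le_of_forall_gt_imp_ge_of_dense fun C hC => sInf_le ⟨bot_le.trans_lt hC, fun t ht => ?_⟩
  have h := mul_meas_ge_le_pow_eLpNorm' diskMeasure (p := ENNReal.ofReal q) (by simpa using hq)
    ENNReal.ofReal_ne_top hf (ENNReal.ofReal t)
  rw [ENNReal.toReal_ofReal hq.le] at h
  have ht' : ENNReal.ofReal t ^ q ≠ 0 := by
    rw [ENNReal.ofReal_rpow_of_pos ht]
    simpa using Real.rpow_pos_of_pos ht q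
  rw [ENNReal.le_div_iff_mul_le (Or.inl ht')
    (Or.inl (ENNReal.rpow_ne_top_of_nonneg hq.le ENNReal.ofReal_ne_top)), mul_comm]
  refine le_trans ?_ (h.trans (by gcongr))
  gcongr
  refine measure_mono fun z (hz : t < ‖f z‖) => ?_
  rw [mem_ofPred_eq, ← ofReal_norm]
  exact ENNReal.ofReal_le_ofReal hz.le

theorem StrongType.weakType {S : (ℂ → ℂ) → ℂ → ℂ} {p q : ℝ} (hq : 0 < q)
    (h : StrongType S p q) : WeakType S p q := by
  obtain ⟨C, hC⟩ := h
  refine ⟨C, fun f hf => ?_⟩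
  obtain ⟨h1, h2⟩ := hC f hf
  have h3 := weakNorm_le_eLpNorm hq h1.1
  exact ⟨⟨h1.1, h3.trans_lt h1.2⟩, h3.trans h2⟩

/-! ### Lower bounds for the kernel and testing on small disks. -/

/-- The product uv lies within ab/2 of ab, so Re(1/(uv)) = Re(uv)/|uv|² ≥ (ab/2)/(3ab/2)², whence
2/9. -/
theorem re_one_div_mul_ge {u v : ℂ} {a b : ℝ} (ha : 0 < a) (hb : 0 < b)
    (hu : ‖u - a‖ ≤ a / 8) (hv : ‖v - b‖ ≤ b / 8) :
    2 / 9 * (1 / (a * b)) ≤ (1 / u * (1 / v)).re := by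
  have hab : 0 < a * b := mul_pos ha hb
  have h1 : ‖u * v - (a * b : ℝ)‖ ≤ a * b / 2 := by
    have e : u * v - (a * b : ℝ) = (u - a) * (v - b) + (u - a) * b + a * (v - b) := by
      push_cast; ring
    rw [e]
    refine (norm_add₃_le).trans ?_
    rw [norm_mul, norm_mul, norm_mul, Complex.norm_real, Complex.norm_real,
      Real.norm_of_nonneg ha.le, Real.norm_of_nonneg hb.le]
    nlinarith [mul_le_mul hu hv (norm_nonneg _) (by positivity),
      mul_le_mul_of_nonneg_right hu hb.le, mul_le_mul_of_nonneg_left hv ha.le]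
  have hre : a * b / 2 ≤ (u * v).re := by
    have := (Complex.abs_re_le_norm (u * v - (a * b : ℝ))).trans h1
    rw [Complex.sub_re, Complex.ofReal_re, abs_le] at this
    linarith [this.1]
  have hn : ‖u * v‖ ≤ 3 / 2 * (a * b) := by
    have := norm_sub_norm_le (u * v) (a * b : ℝ)
    rw [Complex.norm_real, Real.norm_of_nonneg hab.le] at this
    linarith
  have hpos : 0 < ‖u * v‖ := by
    have := Complex.re_le_norm (u * v)
    linarith
  rw [one_div_mul_one_div u v, one_div (u * v), Complex.inv_re, Complex.normSq_eq_norm_sq,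
    mul_one_div, div_le_div_iff₀ hab (by positivity)]
  nlinarith [mul_le_mul hn hn hpos.le (by positivity)]

theorem norm_lt_one_of_mem_ball {t : ℝ} (ht : t ∈ Ioc (0 : ℝ) 1) {z : ℂ}
    (hz : z ∈ Metric.ball ((1 - t : ℝ) : ℂ) (t / 16)) : ‖z‖ < 1 := by
  have h1 := norm_sub_norm_le z ((1 - t : ℝ) : ℂ)
  rw [Complex.norm_real, Real.norm_of_nonneg (by linarith [ht.2])] at h1
  have h2 := mem_ball_iff_norm.1 hz
  linarith [ht.1]

theorem norm_mul_conj_sub_le {t : ℝ} (ht : t ∈ Ioc (0 : ℝ) 1) {z w : ℂ}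
    (hz : z ∈ Metric.ball ((1 - t : ℝ) : ℂ) (t / 16))
    (hw : w ∈ Metric.ball ((1 - t : ℝ) : ℂ) (t / 16)) :
    ‖z * conj w - ((1 - t) ^ 2 : ℝ)‖ ≤ t / 8 := by
  have e : z * conj w - ((1 - t) ^ 2 : ℝ) =
      (z - (1 - t : ℝ)) * conj w + (1 - t : ℝ) * conj (w - (1 - t : ℝ)) := by
    rw [map_sub, Complex.conj_ofReal]; push_cast; ring
  rw [e]
  refine (norm_add_le _ _).trans ?_
  rw [norm_mul, norm_mul, Complex.norm_conj, Complex.norm_conj, Complex.norm_real,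
    Real.norm_of_nonneg (by linarith [ht.2])]
  have h1 := (mem_ball_iff_norm.1 hz).le
  have h2 := (mem_ball_iff_norm.1 hw).le
  have h3 := (norm_lt_one_of_mem_ball ht hw).le
  nlinarith [mul_le_mul h1 h3 (norm_nonneg _) (by linarith [ht.1]), norm_nonneg (w - (1 - t : ℝ)),
    ht.1, mul_le_mul_of_nonneg_right (show 1 - t ≤ 1 by linarith [ht.1])
      (norm_nonneg (w - (1 - t : ℝ)))]

theorem integrable_inner_kernel [IsFiniteMeasure ν] {ζ : ℂ} (hζ : ‖ζ‖ < 1) :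
    Integrable (fun r : Icc (0 : ℝ) 1 => 1 / (1 - ((r : ℝ) : ℂ) * ζ)) ν := by
  have h2 : 0 < ‖1 - ζ‖ := by simpa using norm_one_sub_mul_pos hζ (r := 1) (by simp)
  refine ((integrable_growth ν h2).const_mul 3).mono'
    (Measurable.aestronglyMeasurable (by fun_prop)) (.of_forall fun r => ?_)
  exact norm_inner_kernel_le hζ r.2

/-- On the disk, z w̄ differs from (1-t)² by at most t/8, while at (1-t)² both denominators are real
and at least t. So `re_one_div_mul_ge` applies pointwise in r and no cancellation occurs. The upper
bounds 2t and 2(1 - r + t) for these denominators produce 18 = 4 · 9/2. -/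
theorem re_kernel_ge [IsFiniteMeasure ν] {t : ℝ} (ht : t ∈ Ioc (0 : ℝ) 1) {z w : ℂ}
    (hz : z ∈ Metric.ball ((1 - t : ℝ) : ℂ) (t / 16))
    (hw : w ∈ Metric.ball ((1 - t : ℝ) : ℂ) (t / 16)) :
    growth ν t / (18 * t) ≤ (kernel ν z w).re := by
  have hζ := norm_mul_conj_lt_one (norm_lt_one_of_mem_ball ht hz) (norm_lt_one_of_mem_ball ht hw)
  have hd := norm_mul_conj_sub_le ht hz hw
  set ζ := z * conj w with hζdef
  have hi := (integrable_inner_kernel ν hζ).const_mul (1 / (1 - ζ))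
  rw [kernel_eq, ← integral_const_mul, ← hζdef]
  change _ ≤ RCLike.re (K := ℂ) _
  rw [← integral_re hi, growth, ← integral_div]
  refine integral_mono ((integrable_growth ν ht.1).div_const _) hi.re fun r => ?_
  obtain ⟨hr0, hr1⟩ := r.2
  obtain ⟨ht0, ht1⟩ := ht
  have ha : t ≤ 1 - (1 - t) ^ 2 := by nlinarith
  have hb : t ≤ 1 - r * (1 - t) ^ 2 := by nlinarith [sq_nonneg (1 - t)]
  have hb0 : 0 < 1 - r * (1 - t) ^ 2 := by linarith
  have h := re_one_div_mul_ge (u := 1 - ζ) (v := 1 - (r : ℝ) * ζ) (ht0.trans_le ha)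
    (ht0.trans_le hb) ?_ ?_
  · refine le_trans ?_ h
    have hb2 : 1 - r * (1 - t) ^ 2 ≤ 2 * (1 - r + t) := by
      nlinarith [sq_nonneg (1 - t), mul_nonneg (sub_nonneg.2 hr1) ht0.le]
    have ha2 : 1 - (1 - t) ^ 2 ≤ 2 * t := by nlinarith
    have h3 : 0 < 1 - r + t := by linarith
    calc 1 / (1 - r + t) / (18 * t) = 2 / 9 * (1 / (2 * t * (2 * (1 - r + t)))) := by
          field_simp; norm_num
      _ ≤ _ := by
          have : 0 < (1 - (1 - t) ^ 2) * (1 - r * (1 - t) ^ 2) :=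
            mul_pos (ht0.trans_le ha) hb0
          gcongr
  · have e : 1 - ζ - ((1 - (1 - t) ^ 2 : ℝ) : ℂ) = -(ζ - ((1 - t) ^ 2 : ℝ)) := by
      push_cast; ring
    rw [e, norm_neg]
    linarith
  · have e : 1 - (r : ℝ) * ζ - ((1 - r * (1 - t) ^ 2 : ℝ) : ℂ) =
        -((r : ℝ) * (ζ - ((1 - t) ^ 2 : ℝ))) := by
      push_cast; ring
    rw [e, norm_neg, norm_mul, Complex.norm_real, Real.norm_of_nonneg hr0]
    nlinarith [norm_nonneg (ζ - ((1 - t) ^ 2 : ℝ))]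

theorem diskMeasure_ball {t : ℝ} (ht : t ∈ Ioc (0 : ℝ) 1) :
    diskMeasure (Metric.ball ((1 - t : ℝ) : ℂ) (t / 16)) = ENNReal.ofReal ((t / 16) ^ 2) := by
  have hsub : Metric.ball ((1 - t : ℝ) : ℂ) (t / 16) ⊆ Metric.ball 0 1 := fun z hz => by
    simpa using norm_lt_one_of_mem_ball ht hz
  rw [diskMeasure, Measure.smul_apply, Measure.restrict_apply Metric.isOpen_ball.measurableSet,
    inter_eq_left.2 hsub, Complex.volume_ball, smul_eq_mul,
    ← ENNReal.ofReal_pow (by linarith [ht.1]), ← ENNReal.ofReal_coe_nnreal, NNReal.coe_real_pi,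
    mul_comm, mul_assoc, ENNReal.mul_inv_cancel (by simpa using Real.pi_pos)
      ENNReal.ofReal_ne_top, mul_one]

theorem integrable_kernel [IsFiniteMeasure ν] {z : ℂ} (hz : ‖z‖ < 1) :
    Integrable (kernel ν z) diskMeasure := by
  have hz' : 0 < 1 - ‖z‖ := sub_pos.2 hz
  refine Integrable.of_bound (C := 3 * growth ν (1 - ‖z‖) / (1 - ‖z‖))
    ((stronglyMeasurable_kernel ν).comp_measurable
      measurable_prodMk_left).aestronglyMeasurable ?_
  filter_upwards [ae_norm_lt_one] with w hw
  have h : 1 - ‖z‖ ≤ ‖1 - z * conj w‖ := by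
    have := norm_sub_norm_le (1 : ℂ) (z * conj w)
    rw [norm_one, norm_mul, Complex.norm_conj] at this
    nlinarith [norm_nonneg z]
  refine (norm_kernel_le ν hz hw).trans ?_
  have h1 := growth_antitone ν hz' h
  have h2 := growth_nonneg ν hz'.le
  gcongr

/-- Testing the operator on the indicator function of a disk at height `t`. -/
theorem norm_T_indicator_ge [IsFiniteMeasure ν] {t : ℝ} (ht : t ∈ Ioc (0 : ℝ) 1) {z : ℂ}
    (hz : z ∈ Metric.ball ((1 - t : ℝ) : ℂ) (t / 16)) :
    -- 4608 = 18 · 16²: the kernel bound times the measure (t/16)² of the disk.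
    t * growth ν t / 4608 ≤
      ‖T ν ((Metric.ball ((1 - t : ℝ) : ℂ) (t / 16)).indicator 1) z‖ := by
  set B := Metric.ball ((1 - t : ℝ) : ℂ) (t / 16) with hB
  have hBm : MeasurableSet B := Metric.isOpen_ball.measurableSet
  have hint := (integrable_kernel ν (norm_lt_one_of_mem_ball ht hz)).integrableOn (s := B)
  have e : T ν (B.indicator 1) z = ∫ w in B, kernel ν z w ∂diskMeasure := by
    rw [T, ← integral_indicator hBm]
    congr 1 with w
    by_cases hw : w ∈ B <;> simp [hw]
  rw [e]
  refine le_trans ?_ (Complex.re_le_norm _)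
  change _ ≤ RCLike.re (K := ℂ) _
  rw [← integral_re hint]
  have h : ∫ w in B, growth ν t / (18 * t) ∂diskMeasure ≤
      ∫ w in B, RCLike.re (kernel ν z w) ∂diskMeasure :=
    setIntegral_mono_on (integrableOn_const (measure_ne_top _ _)) hint.re hBm
      fun w hw => re_kernel_ge ν ht hz hw
  refine le_trans (le_of_eq ?_) h
  have := ht.1
  rw [setIntegral_const, measureReal_def, diskMeasure_ball ht,
    ENNReal.toReal_ofReal (by positivity), smul_eq_mul]
  field_simp
  ring

theorem growth_le_of_weakType [IsFiniteMeasure ν] {p q : ℝ} (hp : 0 < p) (hq : 0 < q)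
    (h : WeakType (T ν) p q) :
    ∃ C : ℝ, ∀ t ∈ Ioc (0 : ℝ) 1, growth ν t ≤ C * t ^ (2 / p - 2 / q - 1) := by
  obtain ⟨C, hC⟩ := h
  -- 9216 = 2 · 4608 puts the level s strictly below the lower bound for |T_ν 1_B|, as the strict
  -- inequality in `distribution` requires. C + 1 makes the weak norm strictly smaller than the
  -- chosen bound, so an admissible constant can be extracted from the infimum.
  refine ⟨9216 * (C + 1) * 16⁻¹ ^ (2 / p - 2 / q), fun t ht => ?_⟩
  obtain ⟨ht0, ht1⟩ := id ht
  rcases (growth_nonneg ν ht0.le).eq_or_lt with hg | hg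
  · rw [← hg]; positivity
  set B := Metric.ball ((1 - t : ℝ) : ℂ) (t / 16) with hB
  have hBm : MeasurableSet B := Metric.isOpen_ball.measurableSet
  have hμB := diskMeasure_ball ht
  rw [← hB] at hμB
  have hp' : ENNReal.ofReal p ≠ 0 := by simpa using hp
  have hf : MemLp (B.indicator (1 : ℂ → ℂ)) (ENNReal.ofReal p) diskMeasure :=
    memLp_indicator_const _ hBm 1 (Or.inr (measure_ne_top _ _))
  have hnorm : eLpNorm (B.indicator (1 : ℂ → ℂ)) (ENNReal.ofReal p) diskMeasure =
      ENNReal.ofReal ((t / 16) ^ (2 / p)) := by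
    have := eLpNorm_indicator_const (μ := diskMeasure) (c := (1 : ℂ)) hBm hp'
      ENNReal.ofReal_ne_top
    refine this.trans ?_
    rw [hμB, ENNReal.toReal_ofReal hp.le, enorm_one, one_mul,
      ENNReal.ofReal_rpow_of_pos (by positivity), ← Real.rpow_natCast, ← Real.rpow_mul (by positivity)]
    congr 2
    push_cast; ring
  have hlt : weakNorm (T ν (B.indicator 1)) q <
      ENNReal.ofReal ((C + 1) * (t / 16) ^ (2 / p)) := by
    refine (hC _ hf).2.trans_lt ?_
    rw [hnorm, ← ENNReal.ofReal_coe_nnreal, ← ENNReal.ofReal_mul (by positivity)]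
    exact (ENNReal.ofReal_lt_ofReal_iff (by positivity)).2
      (by gcongr; linarith)
  obtain ⟨N, ⟨-, hN⟩, hNlt⟩ := sInf_lt_iff.1 hlt
  set s : ℝ := t * growth ν t / 9216 with hs
  have hs0 : 0 < s := by positivity
  have hdist : ENNReal.ofReal ((t / 16) ^ 2) ≤ distribution (T ν (B.indicator 1)) s := by
    rw [← hμB]
    refine measure_mono fun z hz => ?_
    refine lt_of_lt_of_le ?_ (norm_T_indicator_ge ν ht hz)
    rw [hs]
    have : 0 < t * growth ν t := by positivity
    linarith
  have hfin : ENNReal.ofReal ((t / 16) ^ 2) ≤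
      ENNReal.ofReal (((C + 1) * (t / 16) ^ (2 / p)) ^ q / s ^ q) := by
    refine (hdist.trans (hN s hs0)).trans ?_
    rw [ENNReal.ofReal_div_of_pos (show 0 < s ^ q by positivity),
      ← ENNReal.ofReal_rpow_of_pos (by positivity),
      ← ENNReal.ofReal_rpow_of_pos hs0]
    gcongr
  rw [ENNReal.ofReal_le_ofReal_iff (by positivity), ← Real.div_rpow (by positivity) hs0.le] at hfin
  have h2 : (t / 16) ^ (2 / q) ≤ (C + 1) * (t / 16) ^ (2 / p) / s := by
    have := Real.rpow_le_rpow (by positivity) hfin (one_div_nonneg.2 hq.le)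
    rwa [← Real.rpow_mul (by positivity), mul_one_div_cancel hq.ne', Real.rpow_one,
      ← Real.rpow_natCast, ← Real.rpow_mul (by positivity), mul_one_div, Nat.cast_ofNat] at this
  have h3 : s ≤ (C + 1) * (t / 16) ^ (2 / p - 2 / q) := by
    rw [Real.rpow_sub (by positivity), ← mul_div_assoc, le_div_iff₀ (by positivity)]
    rwa [le_div_iff₀ hs0, mul_comm] at h2
  rw [div_eq_mul_inv t 16, Real.mul_rpow ht0.le (by norm_num), hs,
    div_le_iff₀ (by norm_num)] at h3
  rw [Real.rpow_sub_one ht0.ne', mul_div_assoc', le_div_iff₀ ht0]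
  linarith

/-! ### The dual index, the critical index and the endpoint mass. -/

theorem dualIndex_one : dualIndex 1 = ∞ := by
  simp [dualIndex, ENNReal.conjExponent]

theorem dualIndex_of_one_lt {c : ℝ} (hc : 1 < c) :
    dualIndex c = ENNReal.ofReal (c / (c - 1)) := by
  have h : 0 < c - 1 := sub_pos.2 hc
  rw [dualIndex, ENNReal.conjExponent, ← ENNReal.ofReal_one, ← ENNReal.ofReal_sub _ zero_le_one,
    ← ENNReal.ofReal_inv_of_pos h, ← ENNReal.ofReal_add zero_le_one (by positivity)]
  congr 1
  field_simp
  ring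

theorem twoDivDual_eq {c : ℝ} (hc : 1 ≤ c) : twoDivDual c = 2 - 2 / c := by
  rcases hc.eq_or_lt with rfl | hc
  · simp [twoDivDual, dualIndex_one]
  · have h : 0 < c - 1 := sub_pos.2 hc
    have h' : 0 < c / (c - 1) := by positivity
    rw [twoDivDual, dualIndex_of_one_lt hc, ENNReal.toReal_div, ENNReal.toReal_ofReal h'.le,
      ENNReal.toReal_ofNat]
    field_simp

/-- The condition p < c' makes 1/q positive, so that q is a genuine finite exponent. -/
theorem one_div_add_one_div_sub_one_pos {c p : ℝ} (hc : 1 ≤ c) (hp : 0 < p)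
    (h : ENNReal.ofReal p < dualIndex c) : 0 < 1 / p + 1 / c - 1 := by
  rcases hc.eq_or_lt with rfl | hc
  · simpa using hp
  · have h1 : 0 < c - 1 := sub_pos.2 hc
    rw [dualIndex_of_one_lt hc, ENNReal.ofReal_lt_ofReal_iff (by positivity),
      lt_div_iff₀ h1] at h
    have e : 1 / p + 1 / c - 1 = (c - p * (c - 1)) / (p * c) := by
      have : 0 < c := by linarith
      field_simp
      ring
    rw [e]
    exact div_pos (by linarith) (by positivity)

theorem one_le_criticalIndex [IsFiniteMeasure ν] : 1 ≤ criticalIndex ν := by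
  -- The value c = 1 is always admissible because ν is finite.
  refine le_csSup ⟨2, fun c hc => hc.2.1.le⟩ ⟨le_rfl, by norm_num, ?_⟩
  simp [twoDivDual_eq le_rfl]

/-- The measure has no mass at the endpoint `1` as soon as the critical index exceeds `1`. -/
theorem measure_eq_one_of_one_lt_criticalIndex (h : 1 < criticalIndex ν) :
    ν {r | (r : ℝ) = 1} = 0 := by
  have hne : {c : ℝ | 1 ≤ c ∧ c < 2 ∧
      (∫⁻ r : Icc (0 : ℝ) 1, 1 / ENNReal.ofReal (1 - (r : ℝ) ^ 2) ^ twoDivDual c ∂ν) < ∞}.Nonempty := by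
    by_contra hne
    rw [not_nonempty_iff_eq_empty] at hne
    rw [criticalIndex, hne, Real.sSup_empty] at h
    linarith
  obtain ⟨c, ⟨hc1, -, hc⟩, hlt⟩ := exists_lt_of_lt_csSup hne h
  have hpos : 0 < twoDivDual c := by
    rw [twoDivDual_eq hc1, sub_pos, div_lt_iff₀ (by linarith)]
    linarith
  -- For an admissible c > 1 the integrand is ∞ at r = 1, so finiteness of the integral rules out an
  -- atom there.
  have hae := ae_lt_top' (by fun_prop) hc.ne
  refine measure_mono_null (fun r (hr : (r : ℝ) = 1) => ?_) (ae_iff.1 hae)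
  simpa [hr] using hpos

/-! ### Growth against the Carleson and hyperbolic conditions. -/

theorem isCarleson_of_growth_le [IsFiniteMeasure ν] {α C : ℝ}
    (hC : ∀ t ∈ Ioc (0 : ℝ) 1, growth ν t ≤ C * t ^ (α - 1)) : IsCarleson α ν := by
  refine lt_of_le_of_lt (iSup₂_le fun t ht => ?_) (ENNReal.ofReal_lt_top (r := 2 * C))
  obtain ⟨ht0, ht1⟩ := id ht
  set S : Set (Icc (0 : ℝ) 1) := {r | 1 - t ≤ (r : ℝ) ∧ (r : ℝ) < 1} with hS
  have hSm : MeasurableSet S :=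
    (measurableSet_le measurable_const measurable_subtype_coe).inter
      (measurableSet_lt measurable_subtype_coe measurable_const)
  have hi := integrable_growth ν ht0
  -- On the window one has 1 - r + t ≤ 2t.
  have h1 : ν.real S * (1 / (2 * t)) ≤ growth ν t := by
    have h2 : ∫ _ in S, 1 / (2 * t) ∂ν ≤ ∫ r in S, 1 / (1 - (r : ℝ) + t) ∂ν := by
      refine setIntegral_mono_on (integrableOn_const (measure_ne_top _ _)) hi.integrableOn hSm
        fun r hr => one_div_le_one_div_of_le (by linarith [r.2.2]) ?_
      linarith [hr.1]
    rw [setIntegral_const, smul_eq_mul] at h2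
    refine h2.trans (setIntegral_le_integral hi (.of_forall fun r => ?_))
    exact one_div_nonneg.2 (by linarith [r.2.2])
  have h3 := h1.trans (hC t ht)
  rw [Real.rpow_sub_one ht0.ne'] at h3
  apply ENNReal.div_le_of_le_mul
  rw [ENNReal.ofReal_rpow_of_pos ht0, ← ENNReal.ofReal_mul' (by positivity),
    ← ofReal_measureReal]
  apply ENNReal.ofReal_le_ofReal
  rw [mul_one_div, mul_div_assoc', div_le_div_iff₀ (by positivity) ht0] at h3
  nlinarith

theorem lintegral_Ioi_add_rpow {β x t : ℝ} (hβ : β < -1) (hxt : 0 < x + t) :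
    ∫⁻ s in Ioi x, ENNReal.ofReal ((s + t) ^ β) =
      ENNReal.ofReal ((x + t) ^ (β + 1) / (-(β + 1))) := by
  have h : ∫⁻ s in Ioi x, ENNReal.ofReal ((s + t) ^ β) =
      ∫⁻ u in Ioi (x + t), ENNReal.ofReal (u ^ β) := by
    rw [← lintegral_indicator measurableSet_Ioi, ← lintegral_indicator measurableSet_Ioi,
      ← lintegral_add_right_eq_self
        ((Ioi (x + t)).indicator fun u => ENNReal.ofReal (u ^ β)) t]
    congr 1 with s
    simp [indicator]
  rw [h, ← ofReal_integral_eq_lintegral_ofReal (integrableOn_Ioi_rpow_of_lt hβ hxt),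
    integral_Ioi_rpow_of_lt hβ hxt, div_neg, neg_div]
  filter_upwards [ae_restrict_mem measurableSet_Ioi] with u hu
  exact Real.rpow_nonneg (hxt.trans hu).le _

theorem ofReal_growth [IsFiniteMeasure ν] {t : ℝ} (ht : 0 < t) :
    ENNReal.ofReal (growth ν t) =
      ∫⁻ r : Icc (0 : ℝ) 1, ENNReal.ofReal (1 / (1 - (r : ℝ) + t)) ∂ν :=
  ofReal_integral_eq_lintegral_ofReal (integrable_growth ν ht)
    (.of_forall fun r => one_div_nonneg.2 (by linarith [r.2.2]))

/-- Layer cake: 1/(1 - r + t) is the integral of (s + t)^(-2) over s > 1 - r. After Tonelli and s^α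
≤ (s + t)^α, what remains is the integral of (s + t)^(α-2) over s > 0, which converges because α <
1. -/
theorem growth_le_of_measure_le [IsFiniteMeasure ν] {α A t : ℝ} (hα : α < 1)
    (hA : ∀ s : ℝ, 0 < s → ν {r | 1 - (r : ℝ) < s} ≤ ENNReal.ofReal (A * s ^ α)) (hA0 : 0 ≤ A)
    (hα0 : 0 ≤ α) (ht : 0 < t) : growth ν t ≤ A / (1 - α) * t ^ (α - 1) := by
  have h1α : 0 < 1 - α := sub_pos.2 hα
  rw [← ENNReal.ofReal_le_ofReal_iff (by positivity), ofReal_growth ν ht]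
  have e : ∀ r : Icc (0 : ℝ) 1, ENNReal.ofReal (1 / (1 - (r : ℝ) + t)) =
      ∫⁻ s in Ioi (0 : ℝ), {p : Icc (0 : ℝ) 1 × ℝ | 1 - (p.1 : ℝ) < p.2}.indicator
        (fun p => ENNReal.ofReal ((p.2 + t) ^ (-2 : ℝ))) (r, s) := by
    intro r
    have hr : 0 ≤ 1 - (r : ℝ) := sub_nonneg.2 r.2.2
    have h := lintegral_Ioi_add_rpow (β := -2) (x := 1 - r) (t := t) (by norm_num) (by linarith)
    have h' : (1 - (r : ℝ) + t) ^ (-2 + 1 : ℝ) / (-(-2 + 1)) = 1 / (1 - (r : ℝ) + t) := by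
      norm_num [Real.rpow_neg_one]
    rw [h'] at h
    rw [← h, ← inter_eq_left.2 (Ioi_subset_Ioi hr), ← setLIntegral_indicator measurableSet_Ioi]
    rfl
  have hm : MeasurableSet {p : Icc (0 : ℝ) 1 × ℝ | 1 - (p.1 : ℝ) < p.2} :=
    measurableSet_lt (by fun_prop) (by fun_prop)
  simp_rw [e]
  rw [lintegral_lintegral_swap (by
    exact ((by fun_prop : Measurable fun p : Icc (0 : ℝ) 1 × ℝ =>
      ENNReal.ofReal ((p.2 + t) ^ (-2 : ℝ))).indicator hm).aemeasurable)]
  have e2 : ∀ s ∈ Ioi (0 : ℝ), ∫⁻ r, {p : Icc (0 : ℝ) 1 × ℝ | 1 - (p.1 : ℝ) < p.2}.indicator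
        (fun p => ENNReal.ofReal ((p.2 + t) ^ (-2 : ℝ))) (r, s) ∂ν ≤
      ENNReal.ofReal A * ENNReal.ofReal ((s + t) ^ (α - 2)) := by
    intro s (hs : 0 < s)
    have hms : MeasurableSet {r : Icc (0 : ℝ) 1 | 1 - (r : ℝ) < s} :=
      measurableSet_lt (by fun_prop) (by fun_prop)
    calc _ = ∫⁻ r, {r : Icc (0 : ℝ) 1 | 1 - (r : ℝ) < s}.indicator
          (fun _ => ENNReal.ofReal ((s + t) ^ (-2 : ℝ))) r ∂ν := rfl
      _ = ENNReal.ofReal ((s + t) ^ (-2 : ℝ)) * ν {r | 1 - (r : ℝ) < s} :=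
        lintegral_indicator_const hms _
      _ ≤ ENNReal.ofReal ((s + t) ^ (-2 : ℝ)) * ENNReal.ofReal (A * s ^ α) := by
        gcongr
        exact hA s hs
      _ ≤ _ := by
        rw [← ENNReal.ofReal_mul (by positivity), ← ENNReal.ofReal_mul hA0]
        apply ENNReal.ofReal_le_ofReal
        rw [sub_eq_neg_add, Real.rpow_add (by positivity)]
        have : s ^ α ≤ (s + t) ^ α := Real.rpow_le_rpow hs.le (by linarith) hα0
        calc _ ≤ (s + t) ^ (-2 : ℝ) * (A * (s + t) ^ α) := by gcongr
          _ = _ := by ring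
  refine (setLIntegral_mono' measurableSet_Ioi e2).trans ?_
  rw [lintegral_const_mul' _ _ ENNReal.ofReal_ne_top,
    lintegral_Ioi_add_rpow (by linarith) (by linarith), ← ENNReal.ofReal_mul hA0, zero_add]
  apply ENNReal.ofReal_le_ofReal
  rw [show α - 2 + 1 = α - 1 by ring, neg_sub]
  exact (by ring : A * (t ^ (α - 1) / (1 - α)) = A / (1 - α) * t ^ (α - 1)).le

theorem IsCarleson.growth_le [IsFiniteMeasure ν] {α : ℝ} (hα0 : 0 ≤ α) (hα1 : α < 1)
    (h1 : 0 < α → ν {r | (r : ℝ) = 1} = 0) (h : IsCarleson α ν) :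
    ∃ C : ℝ, ∀ t ∈ Ioc (0 : ℝ) 1, growth ν t ≤ C * t ^ (α - 1) := by
  rw [IsCarleson] at h
  set M := ⨆ t ∈ Ioc (0 : ℝ) 1,
    ν {r | 1 - t ≤ (r : ℝ) ∧ (r : ℝ) < 1} / ENNReal.ofReal t ^ α with hM
  -- The total mass is added to cover s ≥ 1, and also α = 0, where an atom at r = 1 is permitted and
  -- the Carleson condition is not needed.
  refine ⟨(M.toReal + ν.real univ) / (1 - α), fun t ht =>
    growth_le_of_measure_le ν hα1 (fun s hs => ?_) (by positivity) hα0 ht.1⟩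
  have huniv : 1 ≤ s ^ α → ν {r | 1 - (r : ℝ) < s} ≤
      ENNReal.ofReal ((M.toReal + ν.real univ) * s ^ α) := fun hs1 => by
    rw [← ofReal_measureReal]
    apply ENNReal.ofReal_le_ofReal
    have h2 : ν.real {r | 1 - (r : ℝ) < s} ≤ ν.real univ := measureReal_mono (subset_univ _)
    have h3 : 0 ≤ ν.real univ := measureReal_nonneg
    nlinarith [ENNReal.toReal_nonneg (a := M)]
  rcases hα0.eq_or_lt with rfl | hα
  · exact huniv (by simp)
  rcases le_total 1 s with hs1 | hs1
  · exact huniv (Real.one_le_rpow hs1 hα0)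
  · have hle : ν {r | 1 - s ≤ (r : ℝ) ∧ (r : ℝ) < 1} / ENNReal.ofReal s ^ α ≤ M :=
      le_iSup₂ (f := fun t (_ : t ∈ Ioc (0 : ℝ) 1) =>
        ν {r | 1 - t ≤ (r : ℝ) ∧ (r : ℝ) < 1} / ENNReal.ofReal t ^ α) s ⟨hs, hs1⟩
    have hpos : 0 < s ^ α := Real.rpow_pos_of_pos hs α
    rw [ENNReal.ofReal_rpow_of_pos hs, ENNReal.div_le_iff (by simpa using hpos)
      ENNReal.ofReal_ne_top] at hle
    calc ν {r | 1 - (r : ℝ) < s} ≤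
          ν ({r | 1 - s ≤ (r : ℝ) ∧ (r : ℝ) < 1} ∪ {r | (r : ℝ) = 1}) := by
          refine measure_mono fun r (hr : 1 - (r : ℝ) < s) => ?_
          rcases r.2.2.eq_or_lt with h | h
          · exact Or.inr h
          · exact Or.inl ⟨by linarith, h⟩
      _ ≤ M * ENNReal.ofReal (s ^ α) := by
          refine (measure_union_le _ _).trans ?_
          rwa [h1 hα, add_zero]
      _ ≤ _ := by
          rw [ENNReal.ofReal_mul (by positivity)]
          gcongr
          rw [ENNReal.ofReal_add ENNReal.toReal_nonneg measureReal_nonneg,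
            ENNReal.ofReal_toReal h.ne]
          exact le_self_add

theorem HyperbolicIntegrable.growth_le [IsFiniteMeasure ν] (h1 : ν {r | (r : ℝ) = 1} = 0)
    (h : HyperbolicIntegrable ν) : ∃ C : ℝ, ∀ t ∈ Ioc (0 : ℝ) 1, growth ν t ≤ C := by
  rw [HyperbolicIntegrable] at h
  set M := ∫⁻ r in {r : Icc (0 : ℝ) 1 | (r : ℝ) < 1}, ENNReal.ofReal (1 / (1 - (r : ℝ) ^ 2)) ∂ν
    with hM
  refine ⟨2 * M.toReal, fun t ht => ?_⟩
  rw [← ENNReal.ofReal_le_ofReal_iff (by positivity), ofReal_growth ν ht.1,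
    ENNReal.ofReal_mul zero_le_two, ENNReal.ofReal_toReal h.ne]
  have hms : MeasurableSet {r : Icc (0 : ℝ) 1 | (r : ℝ) < 1} :=
    measurableSet_lt (by fun_prop) (by fun_prop)
  have hae : ∀ᵐ r ∂ν, r ∈ {r : Icc (0 : ℝ) 1 | (r : ℝ) < 1} := by
    refine measure_mono_null (fun r hr => ?_) h1
    exact r.2.2.antisymm (not_lt.1 hr)
  rw [← Measure.restrict_eq_self_of_ae_mem hae, hM,
    ← lintegral_const_mul' _ _ ENNReal.ofReal_ne_top]
  refine setLIntegral_mono' hms fun r (hr : (r : ℝ) < 1) => ?_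
  rw [← ENNReal.ofReal_mul zero_le_two]
  apply ENNReal.ofReal_le_ofReal
  have hr0 := r.2.1
  have ht0 := ht.1
  -- The factor 2 comes from 1 - r² ≤ 2(1 - r) ≤ 2(1 - r + t).
  rw [mul_one_div, div_le_div_iff₀ (by linarith) (by nlinarith)]
  nlinarith

/-- Fatou along t = 1/(n+1), together with 1 - r ≤ 1 - r². -/
theorem hyperbolicIntegrable_of_growth_le [IsFiniteMeasure ν] {C : ℝ}
    (hC : ∀ t ∈ Ioc (0 : ℝ) 1, growth ν t ≤ C) : HyperbolicIntegrable ν := by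
  have hms : MeasurableSet {r : Icc (0 : ℝ) 1 | (r : ℝ) < 1} :=
    measurableSet_lt (by fun_prop) (by fun_prop)
  have hmem : ∀ n : ℕ, (1 / ((n : ℝ) + 1)) ∈ Ioc (0 : ℝ) 1 := fun n =>
    ⟨by positivity, by rw [div_le_one (by positivity)]; linarith [n.cast_nonneg (α := ℝ)]⟩
  refine lt_of_le_of_lt ?_ (ENNReal.ofReal_lt_top (r := C))
  calc _ ≤ ∫⁻ r in {r : Icc (0 : ℝ) 1 | (r : ℝ) < 1}, Filter.liminf (fun n : ℕ =>
        ENNReal.ofReal (1 / (1 - (r : ℝ) + 1 / ((n : ℝ) + 1)))) Filter.atTop ∂ν := by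
        refine setLIntegral_mono' hms fun r (hr : (r : ℝ) < 1) => ?_
        have hr' : 0 < 1 - (r : ℝ) := sub_pos.2 hr
        have hlim : Filter.Tendsto (fun n : ℕ =>
            ENNReal.ofReal (1 / (1 - (r : ℝ) + 1 / ((n : ℝ) + 1)))) Filter.atTop
            (nhds (ENNReal.ofReal (1 / (1 - (r : ℝ) + 0)))) :=
          ENNReal.tendsto_ofReal ((tendsto_const_nhds.div
            (tendsto_const_nhds.add tendsto_one_div_add_atTop_nhds_zero_nat) (by linarith)))
        rw [hlim.liminf_eq, add_zero]
        apply ENNReal.ofReal_le_ofReal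
        exact one_div_le_one_div_of_le hr' (by nlinarith [r.2.1])
    _ ≤ Filter.liminf (fun n : ℕ => ∫⁻ r in {r : Icc (0 : ℝ) 1 | (r : ℝ) < 1},
        ENNReal.ofReal (1 / (1 - (r : ℝ) + 1 / ((n : ℝ) + 1))) ∂ν) Filter.atTop :=
        lintegral_liminf_le fun n => by fun_prop
    _ ≤ _ := by
        refine Filter.liminf_le_of_le (by isBoundedDefault) fun b hb => ?_
        obtain ⟨n, hn⟩ := hb.exists
        refine hn.trans ((setLIntegral_le_lintegral _ _).trans ?_)
        rw [← ofReal_growth ν (hmem n).1]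
        exact ENNReal.ofReal_le_ofReal (hC _ (hmem n))

/-! ### Assembly of the equivalences. -/

theorem tfae_of_growth_iff [IsFiniteMeasure ν] {p q c : ℝ} (hp : 1 < p) (hpq : p ≤ q)
    (hc : 1 / q = 1 / p + 1 / c - 1) {P : Prop}
    (hP : P ↔ ∃ C : ℝ, ∀ t ∈ Ioc (0 : ℝ) 1, growth ν t ≤ C * t ^ (1 - 2 / c)) :
    List.TFAE [WeakType (T ν) p q, StrongType (T ν) p q, P] := by
  tfae_have 2 → 1 := StrongType.weakType (by linarith)
  tfae_have 3 → 2 := fun h => by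
    obtain ⟨C, hC⟩ := hP.1 h
    exact strongType_of_growth_le ν hp hpq hc hC
  tfae_have 1 → 3 := fun h => by
    -- The exponent found by testing on disks coincides with the one sufficient for the strong
    -- bound, which closes the cycle.
    have e : 2 / p - 2 / q - 1 = 1 - 2 / c := by
      simp only [one_div] at hc
      simp only [div_eq_mul_inv]
      linear_combination -2 * hc
    rw [hP, ← e]
    exact growth_le_of_weakType ν (by linarith) (by linarith) h
  tfae_finish

end Shimorin
end

theorem mainTheorem3 (ν : MeasureTheory.Measure (Set.Icc (0 : ℝ) 1))
    [MeasureTheory.IsFiniteMeasure ν] (p q : ℝ)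
    (hp : 1 < p)
    (hpc : ENNReal.ofReal p < Shimorin.dualIndex (Shimorin.criticalIndex ν))
    (hq : 1 / q = 1 / p + 1 / Shimorin.criticalIndex ν - 1) :
    (1 ≤ Shimorin.criticalIndex ν ∧ Shimorin.criticalIndex ν < 2 →
      List.TFAE [
        Shimorin.WeakType (Shimorin.T ν) p q,
        Shimorin.StrongType (Shimorin.T ν) p q,
        Shimorin.IsCarleson (Shimorin.twoDivDual (Shimorin.criticalIndex ν)) ν]) ∧
    (Shimorin.criticalIndex ν = 2 →
      (p < 2 ∧ q = 2 * p / (2 - p)) ∧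
      List.TFAE [
        Shimorin.WeakType (Shimorin.T ν) p q,
        Shimorin.StrongType (Shimorin.T ν) p q,
        Shimorin.HyperbolicIntegrable ν]) := by
  have hc1 := Shimorin.one_le_criticalIndex ν
  have hend := Shimorin.measure_eq_one_of_one_lt_criticalIndex ν
  set c := Shimorin.criticalIndex ν
  have hp0 : 0 < p := by linarith
  have hqinv : 0 < 1 / q := by
    rw [hq]
    exact Shimorin.one_div_add_one_div_sub_one_pos hc1 hp0 hpc
  have hq0 : 0 < q := one_div_pos.1 hqinv
  have hpq : p ≤ q := by
    rw [← one_div_le_one_div hq0 hp0, hq]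
    have : 1 / c ≤ 1 := by rw [div_le_one (by linarith)]; exact hc1
    linarith
  refine ⟨fun ⟨_, hc2⟩ => ?_, fun hc2 => ⟨?_, ?_⟩⟩
  · refine Shimorin.tfae_of_growth_iff ν hp hpq hq ?_
    have hα := Shimorin.twoDivDual_eq hc1
    have e : 1 - 2 / c = Shimorin.twoDivDual c - 1 := by rw [hα]; ring
    rw [e]
    refine ⟨Shimorin.IsCarleson.growth_le ν ?_ ?_ fun h => hend ?_,
      fun ⟨C, hC⟩ => Shimorin.isCarleson_of_growth_le ν hC⟩
    · rw [hα, sub_nonneg, div_le_iff₀ (by linarith)]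
      linarith
    · rw [hα, sub_lt_comm, lt_div_iff₀ (by linarith)]
      linarith
    · rw [hα, sub_pos, div_lt_iff₀ (by linarith)] at h
      linarith
  · rw [hc2] at hq
    have h2 : 1 / q = (2 - p) / (2 * p) := by
      rw [hq]
      field_simp
      ring
    have h3 : 0 < 2 - p := by
      rw [h2, div_pos_iff_of_pos_right (by positivity)] at hqinv
      exact hqinv
    exact ⟨by linarith, by rw [← one_div_one_div q, h2, one_div_div]⟩
  · refine Shimorin.tfae_of_growth_iff ν hp hpq hq ?_
    -- At c = 2 the exponent vanishes and the growth condition becomes boundedness.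
    have e : ∀ C t : ℝ, C * t ^ (1 - 2 / c) = C := fun C t => by rw [hc2]; norm_num
    simp_rw [e]
    exact ⟨Shimorin.HyperbolicIntegrable.growth_le ν (hend (by rw [hc2]; norm_num)),
      fun ⟨C, hC⟩ => Shimorin.hyperbolicIntegrable_of_growth_le ν hC⟩
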